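/- Let $(\mathcal B,\|\cdot\|)$ be a real Banach space that is $(\sigma,p)$-smooth, where $\sigma\ge 0$ and $1<p\le 2$; that is, $g=\|\cdot\|^p/p$ is differentiable and $$g(z)\le g(z')+\langle\nabla g(z'),z-z'\rangle+\tfrac{\sigma}{p}\|z-z'\|^p\qquad\text{for all } z,z'\in\mathcal B .$$ Let $G:\mathcal B\to[0,\infty)$ be $1$-Lipschitz with respect to $\|\cdot\|$ with $G(0)=0$. Let $T\ge 2$ be an integer, $\mathcal H\subseteq\mathcal B$, $\mathcal F$ and $\mathcal X$ sets, $\ell:\mathcal F\times\mathcal X\to\mathcal H$ a payoff function, and $\Phi_T$ a set of sequences $\boldsymbol\phi=(\phi_1,\dots,\phi_T)$ of payoff transformations $\phi_t:\mathcal H^{\mathcal F\times\mathcal X}\to\mathcal H^{\mathcal F\times\mathcal X}$; write $\ell_{\phi_t}=\phi_t(\ell)$, and assume $\|\ell_{\phi_t}(f,x)\|\le 1$ for all $f\in\mathcal F$, $x\in\mathcal X$, $\boldsymbol\phi\in\Phi_T$, $1\le t\le T$. A $\mathcal Z$-valued tree of depth $T$ is a sequence $\mathbf z=(\mathbf z_1,\dots,\mathbf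 z_T)$ of maps $\mathbf z_t:\{\pm1\}^{t-1}\to\mathcal Z$; for $\epsilon\in\{\pm1\}^T$ write $\mathbf z_t(\epsilon)=\mathbf z_t(\epsilon_1,\dots,\epsilon_{t-1})$. For $\delta>0$ and an $(\mathcal F\times\mathcal X)$-valued tree $(\mathbf f,\mathbf x)$ of depth $T$, let $\mathcal N_\infty(\delta,\Phi_T,(\mathbf f,\mathbf x))\in\mathbb N\cup\{\infty\}$ be the least cardinality of a set $V$ of $\mathcal H$-valued trees of depth $T$ such that for all $\boldsymbol\phi\in\Phi_T$ and $\epsilon\in\{\pm1\}^T$ there is $\mathbf v\in V$ with $\max_{t}\|\mathbf v_t(\epsilon)-\ell_{\phi_t}(\mathbf f_t(\epsilon),\mathbf x_t(\epsilon))\|\le\delta$, and let $\mathcal N_\infty(\delta)=\mathcal N_\infty(\delta,\Phi_T,T)=\sup_{(\mathbf f,\mathbf x)}\mathcal N_\infty(\delta,\Phi_T,(\mathbf f,\mathbf x))$. Assume that $\mathcal N_\infty(\delta)\ge 2$ for every $0<\delta<1/4$. Let $L$ be a real number with $L>2\sum_{j=1}^\infty \mathcal N_\infty(2^{-j})^{-1}$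 (where $\infty^{-1}=0$; in particular the sum is finite). Then for every $\theta>\dfrac{1024\,\sigma^{1/p}\log^{3/2}T}{T^{1-1/p}}$ and every $(\mathcal F\times\mathcal X)$-valued tree $(\mathbf f,\mathbf x)$ of depth $T$, if $\epsilon$ is uniformly distributed on $\{\pm1\}^T$, $$\mathbb P_\epsilon\left(\sup_{\boldsymbol\phi\in\Phi_T}G\Big(\frac1T\sum_{t=1}^T\epsilon_t\,\ell_{\phi_t}(\mathbf f_t(\epsilon),\mathbf x_t(\epsilon))\Big)>\frac{768\,\sigma^{1/p}}{T^{1-1/p}}+\inf_{0<\alpha\le1}\Big\{4\alpha+36\,\theta\int_\alpha^1\sqrt{\log\mathcal N_\infty(\delta)}\,d\delta\Big\}\right)\le L\exp\left(-\frac{\theta^2\,T^{2-2/p}}{65536\,\sigma^{2/p}\log^3T}\right),$$ where $\sqrt{\log\infty}=\infty$ and the infimum is taken in $[0,\infty]$. -/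

import Mathlib

open Set MeasureTheory
open scoped ENNReal

noncomputable section

/-- A `Z`-valued binary tree of depth `T`: a sequence of `T` maps, the map with (zero-based)
index `t` being defined on `{±1}^t`. -/
def SignTree (T : ℕ) (Z : Type*) : Type _ := (t : Fin T) → (Fin t.val → ℤˣ) → Z

/-- The value of the tree at level `t` along the path `ε`; it depends only on the signs of `ε`
that precede `t`. -/
def SignTree.along {T : ℕ} {Z : Type*} (z : SignTree T Z) (ε : Fin T → ℤˣ) (t : Fin T) : Z :=
  z t (fun s => ε (Fin.castLE t.isLt.le s))

/-- Probability of an event under `T` independent uniform random signs, that is, under the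
uniform distribution on `{±1}^T`. -/
def signProb {T : ℕ} (E : Set (Fin T → ℤˣ)) : ℝ≥0∞ :=
  (PMF.uniformOfFintype (Fin T → ℤˣ)).toOuterMeasure E

/-- `G` is `(σ, p)`-uniformly smooth on the whole space. -/
def IsUniformlySmooth {B : Type*} [NormedAddCommGroup B] [NormedSpace ℝ B]
    (G : B → ℝ) (σ p : ℝ) : Prop :=
  0 ≤ σ ∧ 1 < p ∧ p ≤ 2 ∧ Differentiable ℝ G ∧
    ∀ z z' : B, G z ≤ G z' + fderiv ℝ G z' (z - z') + σ / p * ‖z - z'‖ ^ p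

/-- The normed space `B` is `(σ, p)`-smooth: `‖·‖ ^ p / p` is `(σ, p)`-uniformly smooth. -/
def IsSmoothSpace (B : Type*) [NormedAddCommGroup B] [NormedSpace ℝ B] (σ p : ℝ) : Prop :=
  IsUniformlySmooth (fun z : B => ‖z‖ ^ p / p) σ p

/-- A payoff transformation maps `H`-valued payoff functions on `F × X` to such functions. -/
abbrev PayoffTransformation (F X : Type*) {B : Type*} (H : Set B) : Type _ :=
  (F × X → H) → (F × X → H)

section Cover

variable {B : Type*} [NormedAddCommGroup B] {F X : Type*} {H : Set B} {T : ℕ}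

/-- `V` is an `α`-cover, with respect to the `ℓ_∞`-norm, of the class `Φ` of sequences of payoff
transformations on the `(F × X)`-valued tree `fx`. The covering tree may depend on the path. -/
def IsInftyCover (ell : F × X → H) (Φ : Set (Fin T → PayoffTransformation F X H))
    (fx : SignTree T (F × X)) (α : ℝ) (V : Set (SignTree T H)) : Prop :=
  ∀ φ ∈ Φ, ∀ ε : Fin T → ℤˣ, ∃ v ∈ V, ∀ t : Fin T,
    ‖(v.along ε t : B) - (φ t ell (fx.along ε t) : B)‖ ≤ α

/-- The `ℓ_∞` covering number of `Φ` on the tree `fx` at scale `α` (`⊤` if no finite cover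
exists). -/
def coveringNumberOn (ell : F × X → H) (Φ : Set (Fin T → PayoffTransformation F X H))
    (fx : SignTree T (F × X)) (α : ℝ) : ℕ∞ :=
  ⨅ (V : Set (SignTree T H)) (_ : IsInftyCover ell Φ fx α V), V.encard

/-- The maximal `ℓ_∞` covering number of `Φ` at scale `α` over all trees of depth `T`. -/
def coveringNumber (ell : F × X → H) (Φ : Set (Fin T → PayoffTransformation F X H))
    (α : ℝ) : ℕ∞ :=
  ⨆ fx : SignTree T (F × X), coveringNumberOn ell Φ fx α

end Cover

/-- `√(log n)` for `n ≥ 1`, with value `⊤` at `n = ⊤`. -/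
def sqrtLog (n : ℕ∞) : ℝ≥0∞ :=
  (ENNReal.log (n : ℝ≥0∞)).toENNReal ^ (1 / 2 : ℝ)

/-- `inf_{0 < α ≤ 1} { 4 α + c ∫_α^1 √(log N(δ)) dδ }`, with values in `[0, ∞]`. -/
def dudleyBound (N : ℝ → ℕ∞) (c : ℝ) : ℝ≥0∞ :=
  ⨅ α ∈ Set.Ioc (0 : ℝ) 1,
    ENNReal.ofReal (4 * α) + ENNReal.ofReal c * ∫⁻ δ in Set.Ioc α 1, sqrtLog (N δ)

end

/-!
The deviation bound is proved by a chaining argument over the dyadic scales `2⁻ʲ`, resting on a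
sub-Gaussian tail for a single tree. Write `A = (σ T) ^ (1 / p)`.

For one tree with values in the unit ball, consider the regularized norm
`x ↦ (A ^ p + ‖x‖ ^ p) ^ (1 / p)` (`smoothNorm`). It is `1`-Lipschitz, and `(σ, p)`-smoothness
together with the tangent inequality for `x ^ p` shows that its average over `x + h` and `x - h`
exceeds its value at `x` by at most `A / T`
(`IsSmoothSpace.smoothNorm_add_add_smoothNorm_sub_le`). Hence, along the signed sum of the tree,
its exponential moment of order `c` grows by a factor of at most `exp (c A / T + c ^ 2 / 2)` per
step, and since it starts at `A`, the norm of the sum exceeds `2 A + u` with probability at most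
`exp (-u ^ 2 / (2 T))` (`IsSmoothSpace.signProb_norm_signedSum_le`). No logarithm of `T` is lost
in this step.

For the supremum over `Φ`, take finite covers at the scales `2⁻ʲ`, with the zero tree as the
coarsest. Along a path, the payoffs are the sum of an error of size `2⁻ᴶ` and of increments between
consecutive covers (`norm_average_le_chaining`). An increment is small only along the path in
question; truncating each difference of trees makes it bounded everywhere without changing it along
that path, so that the tail bound and a union bound apply to each level. With deviations of
`θ T (1 / 8 + √(log N))`, where `N` is the covering number at scale `2⁻ʲ`, level `j` fails with
probability at most `N⁻¹` times the target exponential (`sq_mul_exp_le_inv_mul_exp`), and these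
probabilities sum to at most `L` times it. Off the union of these events, which does not depend on
`α`, the bound holds for every `α` simultaneously (`le_entropy_bound_of_chaining`). As the covering
number may be `1` at the two coarsest scales, the deviation has a part free of entropy; it is paid
for by the part of the entropy integral below `1 / 4`, where the covering number is at least `2`.
-/

/-! ### Smoothness of the regularized norm -/

section SmoothSpace

variable {B : Type*} [NormedAddCommGroup B] [NormedSpace ℝ B] {σ p : ℝ}

/-- Averaging the smoothness inequality over `h` and `-h` removes the derivative. -/
theorem IsSmoothSpace.norm_add_rpow_add_norm_sub_rpow_le (hB : IsSmoothSpace B σ p) (x h : B) :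
    ‖x + h‖ ^ p + ‖x - h‖ ^ p ≤ 2 * ‖x‖ ^ p + 2 * σ * ‖h‖ ^ p := by
  obtain ⟨-, hp, -, -, H⟩ := hB
  have hp0 : 0 < p := by linarith
  have h1 := H (x + h) x
  have h2 := H (x - h) x
  simp only [add_sub_cancel_left, sub_sub_cancel_left, map_neg, norm_neg] at h1 h2
  have h3 : (‖x + h‖ ^ p + ‖x - h‖ ^ p) / p ≤ (2 * ‖x‖ ^ p + 2 * σ * ‖h‖ ^ p) / p := by
    have e1 : (‖x + h‖ ^ p + ‖x - h‖ ^ p) / p = ‖x + h‖ ^ p / p + ‖x - h‖ ^ p / p := by ring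
    have e2 : (2 * ‖x‖ ^ p + 2 * σ * ‖h‖ ^ p) / p
        = 2 * (‖x‖ ^ p / p) + 2 * (σ / p * ‖h‖ ^ p) := by ring
    rw [e1, e2]
    linarith
  exact (div_le_div_iff_of_pos_right hp0).1 h3

theorem IsSmoothSpace.one_le_of_nontrivial [Nontrivial B] (hB : IsSmoothSpace B σ p) :
    1 ≤ σ := by
  obtain ⟨z, hz⟩ := exists_ne (0 : B)
  have hp : 0 < p := by linarith [hB.2.1]
  have h := hB.norm_add_rpow_add_norm_sub_rpow_le 0 z
  simp only [zero_add, zero_sub, norm_neg, norm_zero, Real.zero_rpow hp.ne'] at h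
  have hz' : 0 < ‖z‖ ^ p := Real.rpow_pos_of_pos (norm_pos_iff.2 hz) p
  nlinarith

end SmoothSpace

section SmoothNorm

variable {B : Type*} [NormedAddCommGroup B] {p : ℝ}

/-- The norm regularized at scale `A`: the `ℓ_p`-norm of the pair `(A, ‖x‖)`. -/
noncomputable def smoothNorm (A p : ℝ) (x : B) : ℝ := (A ^ p + ‖x‖ ^ p) ^ (1 / p)

theorem smoothNorm_rpow {A : ℝ} (hA : 0 ≤ A) (hp : 0 < p) (x : B) :
    smoothNorm A p x ^ p = A ^ p + ‖x‖ ^ p := by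
  rw [smoothNorm, ← Real.rpow_mul (by positivity), one_div_mul_cancel hp.ne', Real.rpow_one]

theorem smoothNorm_nonneg {A : ℝ} (hA : 0 ≤ A) (x : B) : 0 ≤ smoothNorm A p x := by
  unfold smoothNorm; positivity

theorem le_smoothNorm {A : ℝ} (hA : 0 ≤ A) (hp : 0 < p) (x : B) : A ≤ smoothNorm A p x := by
  rw [← Real.rpow_le_rpow_iff hA (smoothNorm_nonneg hA x) hp, smoothNorm_rpow hA hp]
  linarith [Real.rpow_nonneg (norm_nonneg x) p]

theorem norm_le_smoothNorm {A : ℝ} (hA : 0 ≤ A) (hp : 0 < p) (x : B) :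
    ‖x‖ ≤ smoothNorm A p x := by
  rw [← Real.rpow_le_rpow_iff (norm_nonneg x) (smoothNorm_nonneg hA x) hp, smoothNorm_rpow hA hp]
  linarith [Real.rpow_nonneg hA p]

theorem smoothNorm_zero {A : ℝ} (hA : 0 ≤ A) (hp : 0 < p) : smoothNorm A p (0 : B) = A := by
  rw [smoothNorm, norm_zero, Real.zero_rpow hp.ne', add_zero, ← Real.rpow_mul hA,
    mul_one_div_cancel hp.ne', Real.rpow_one]

theorem smoothNorm_sub_le {A : ℝ} (hA : 0 ≤ A) (hp : 1 ≤ p) (x y : B) :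
    smoothNorm A p x - smoothNorm A p y ≤ ‖x - y‖ := by
  have hp0 : 0 < p := by linarith
  have h := Real.Lp_add_le Finset.univ ![A, ‖y‖] ![0, ‖x - y‖] hp
  simp only [Fin.sum_univ_two, Matrix.cons_val_zero, Matrix.cons_val_one, abs_zero, add_zero,
    Real.zero_rpow hp0.ne', zero_add, abs_norm, abs_of_nonneg hA] at h
  rw [← Real.rpow_mul (norm_nonneg _), mul_one_div_cancel hp0.ne', Real.rpow_one,
    abs_of_nonneg (by positivity)] at h
  have h2 : smoothNorm A p x ≤ (A ^ p + (‖y‖ + ‖x - y‖) ^ p) ^ (1 / p) := by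
    unfold smoothNorm
    have : ‖x‖ ≤ ‖y‖ + ‖x - y‖ := by
      simpa using norm_add_le y (x - y)
    gcongr
  unfold smoothNorm at *
  linarith

end SmoothNorm

section SmoothSpace

variable {B : Type*} [NormedAddCommGroup B] [NormedSpace ℝ B] {σ p : ℝ}

/-- The average of `a` and `b` is controlled by the tangent of `x ^ p` at `c`. -/
theorem average_le_of_rpow_add_rpow_le {a b c s : ℝ} (hp : 1 ≤ p) (ha : 0 ≤ a) (hb : 0 ≤ b)
    (hc : 0 < c) (h : a ^ p + b ^ p ≤ 2 * c ^ p + 2 * s) :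
    (a + b) / 2 ≤ c + s * c / (p * c ^ p) := by
  have hp0 : 0 < p := by linarith
  have hcp : 0 < c ^ p := Real.rpow_pos_of_pos hc p
  have h1 : ((a + b) / 2) ^ p ≤ (a ^ p + b ^ p) / 2 := by
    have := (convexOn_rpow hp).2 (mem_Ici.2 ha) (mem_Ici.2 hb)
      (by norm_num : (0 : ℝ) ≤ 1 / 2) (by norm_num : (0 : ℝ) ≤ 1 / 2) (by norm_num)
    simp only [smul_eq_mul] at this
    rw [show (a + b) / 2 = 1 / 2 * a + 1 / 2 * b by ring]
    linarith
  have h2 := one_add_mul_self_le_rpow_one_add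
    (s := (a + b) / 2 / c - 1) (by have : 0 ≤ (a + b) / 2 / c := by positivity
                                   linarith) hp
  rw [add_sub_cancel, Real.div_rpow (by positivity) hc.le, le_div_iff₀ hcp] at h2
  have h3 : p * ((a + b) / 2 / c - 1) * c ^ p ≤ s := by nlinarith
  have h4 : ((a + b) / 2 - c) ≤ s * c / (p * c ^ p) := by
    rw [le_div_iff₀ (by positivity)]
    have : p * ((a + b) / 2 / c - 1) * c ^ p * c = ((a + b) / 2 - c) * (p * c ^ p) := by
      field_simp
    rw [← this]
    gcongr
  linarith

/-- With `A ^ p = σ τ`, the second-order drift of the regularized norm under a symmetric step of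
length at most `1` is at most `A / τ`, so that `τ` steps cost no more than `A`. -/
theorem IsSmoothSpace.smoothNorm_add_add_smoothNorm_sub_le (hB : IsSmoothSpace B σ p) {A τ : ℝ}
    (hA : 0 < A) (hτ : 0 < τ) (hAp : A ^ p = σ * τ) (x : B) {h : B} (hh : ‖h‖ ≤ 1) :
    (smoothNorm A p (x + h) + smoothNorm A p (x - h)) / 2 ≤ smoothNorm A p x + A / τ := by
  have hp1 : 1 ≤ p := hB.2.1.le
  have hp : 0 < p := by linarith
  have hσ : 0 ≤ σ := hB.1
  have hc : 0 < smoothNorm A p x := hA.trans_le (le_smoothNorm hA.le hp x)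
  have hh' : ‖h‖ ^ p ≤ 1 := Real.rpow_le_one (norm_nonneg h) hh hp.le
  have h1 := average_le_of_rpow_add_rpow_le (s := σ) hp1 (smoothNorm_nonneg (p := p) hA.le (x + h))
    (smoothNorm_nonneg (p := p) hA.le (x - h)) hc (by
      rw [smoothNorm_rpow hA.le hp, smoothNorm_rpow hA.le hp, smoothNorm_rpow hA.le hp]
      have := hB.norm_add_rpow_add_norm_sub_rpow_le x h
      nlinarith)
  refine h1.trans (add_le_add_right ?_ _)
  have hAp0 : 0 < A ^ p := Real.rpow_pos_of_pos hA p
  have h2 : smoothNorm A p x / smoothNorm A p x ^ p ≤ A / A ^ p := by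
    have e : ∀ c : ℝ, 0 < c → c / c ^ p = (c ^ (p - 1))⁻¹ := fun c hc => by
      rw [Real.rpow_sub_one hc.ne', inv_div]
    rw [e _ hc, e _ hA]
    have : 0 < A ^ (p - 1) := Real.rpow_pos_of_pos hA _
    gcongr
    exact le_smoothNorm hA.le hp x
  calc σ * smoothNorm A p x / (p * smoothNorm A p x ^ p)
      = σ / p * (smoothNorm A p x / smoothNorm A p x ^ p) := by
        rw [mul_div_mul_comm]
    _ ≤ σ / p * (A / A ^ p) := by gcongr
    _ ≤ σ * (A / A ^ p) := by
        gcongr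
        exact div_le_self hσ hp1
    _ = A / τ := by
        have : σ ≠ 0 := by rintro rfl; simp at hAp; exact hAp0.ne' hAp
        rw [hAp]; field_simp

/-- One step of the exponential moment recursion. -/
theorem IsSmoothSpace.exp_smoothNorm_add_le (hB : IsSmoothSpace B σ p) {A τ : ℝ}
    (hA : 0 < A) (hτ : 0 < τ) (hAp : A ^ p = σ * τ) {c : ℝ} (hc : 0 ≤ c) (x : B) {h : B}
    (hh : ‖h‖ ≤ 1) :
    Real.exp (c * smoothNorm A p (x + h)) + Real.exp (c * smoothNorm A p (x - h))
      ≤ 2 * Real.exp (c * (A / τ) + c ^ 2 / 2) * Real.exp (c * smoothNorm A p x) := by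
  set a := smoothNorm A p (x + h)
  set b := smoothNorm A p (x - h)
  set d := (a - b) / 2 with hd
  have hp1 : 1 ≤ p := hB.2.1.le
  have hdd : |d| ≤ 1 := by
    have e : x + h - (x - h) = (2 : ℝ) • h := by rw [two_smul]; abel
    have e' : x - h - (x + h) = -((2 : ℝ) • h) := by rw [two_smul]; abel
    have h1 := smoothNorm_sub_le hA.le hp1 (x + h) (x - h)
    have h2 := smoothNorm_sub_le hA.le hp1 (x - h) (x + h)
    rw [e, norm_smul, Real.norm_two] at h1
    rw [e', norm_neg, norm_smul, Real.norm_two] at h2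
    rw [abs_le]
    constructor <;> linarith
  have hm := hB.smoothNorm_add_add_smoothNorm_sub_le hA hτ hAp x hh
  have e : Real.exp (c * a) + Real.exp (c * b)
      = 2 * (Real.exp (c * ((a + b) / 2)) * Real.cosh (c * d)) := by
    rw [Real.cosh_eq, mul_div_assoc', mul_div_cancel₀ _ two_ne_zero, mul_add, ← Real.exp_add,
      ← Real.exp_add]
    congr 2 <;> · rw [hd]; ring
  have hcosh : Real.cosh (c * d) ≤ Real.exp (c ^ 2 / 2) := by
    refine (Real.cosh_le_exp_half_sq _).trans (Real.exp_le_exp.2 ?_)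
    have : d ^ 2 ≤ 1 := by rw [← sq_abs]; exact pow_le_one₀ (abs_nonneg d) hdd
    have : c ^ 2 * d ^ 2 ≤ c ^ 2 * 1 := by gcongr
    rw [mul_pow]; linarith
  rw [e, mul_assoc, ← Real.exp_add]
  refine mul_le_mul_of_nonneg_left ?_ two_pos.le
  calc Real.exp (c * ((a + b) / 2)) * Real.cosh (c * d)
      ≤ Real.exp (c * (smoothNorm A p x + A / τ)) * Real.exp (c ^ 2 / 2) := by
        gcongr
    _ = _ := by rw [← Real.exp_add]; congr 1; ring

end SmoothSpace

/-! ### Concentration of signed sums along a tree -/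

section Concentration

variable {B : Type*} [NormedAddCommGroup B] [NormedSpace ℝ B] {σ p : ℝ}

/-- The subtree of depth `T` that follows the first sign `e`. -/
def SignTree.child {T : ℕ} {Z : Type*} (z : SignTree (T + 1) Z) (e : ℤˣ) : SignTree T Z :=
  fun t s => z t.succ (Fin.cons e s : Fin (t.val + 1) → ℤˣ)

theorem SignTree.along_cons_succ {T : ℕ} {Z : Type*} (z : SignTree (T + 1) Z) (e : ℤˣ)
    (ε : Fin T → ℤˣ) (t : Fin T) :
    z.along (Fin.cons e ε) t.succ = (z.child e).along ε t := by
  unfold SignTree.along SignTree.child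
  congr 1
  funext s
  refine Fin.cases ?_ (fun i => ?_) s <;> rfl

/-- The signed sum `∑ ε_t z_t(ε)` of a tree along a path. -/
noncomputable def SignTree.signedSum {T : ℕ} (z : SignTree T B) (ε : Fin T → ℤˣ) : B :=
  ∑ t : Fin T, ((ε t : ℤ) : ℝ) • z.along ε t

theorem SignTree.signedSum_cons {T : ℕ} (z : SignTree (T + 1) B) (e : ℤˣ) (ε : Fin T → ℤˣ) :
    z.signedSum (Fin.cons e ε)
      = ((e : ℤ) : ℝ) • z 0 Fin.elim0 + (z.child e).signedSum ε := by
  unfold SignTree.signedSum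
  rw [Fin.sum_univ_succ]
  simp only [Fin.cons_zero, Fin.cons_succ, SignTree.along_cons_succ]
  congr 2
  unfold SignTree.along
  congr 1
  funext s
  exact s.elim0

/-- A function that grows by a factor of at most `K` on average under every symmetric step of
length at most `1` grows by a factor of at most `K ^ T` on average along a tree of depth `T`. -/
theorem SignTree.sum_comp_signedSum_le (Ψ : B → ℝ) (K : ℝ) (hK : 0 ≤ K)
    (hΨ : ∀ x h : B, ‖h‖ ≤ 1 → Ψ (x + h) + Ψ (x - h) ≤ 2 * K * Ψ x) :
    ∀ {T : ℕ} (z : SignTree T B), (∀ t s, ‖z t s‖ ≤ 1) → ∀ x : B,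
      ∑ ε : Fin T → ℤˣ, Ψ (x + z.signedSum ε) ≤ (2 * K) ^ T * Ψ x := by
  intro T
  induction T with
  | zero =>
    intro z _ x
    simp [SignTree.signedSum]
  | succ T ih =>
    intro z hz x
    rw [← (Fin.consEquiv (fun _ : Fin (T + 1) => ℤˣ)).sum_comp, Fintype.sum_prod_type]
    have h1 : ∀ e : ℤˣ, ∑ ε : Fin T → ℤˣ,
        Ψ (x + z.signedSum (Fin.consEquiv (fun _ : Fin (T + 1) => ℤˣ) (e, ε)))
          ≤ (2 * K) ^ T * Ψ (x + ((e : ℤ) : ℝ) • z 0 Fin.elim0) := by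
      intro e
      refine le_trans (le_of_eq ?_) (ih (z.child e) (fun t s => hz _ _) _)
      refine Finset.sum_congr rfl fun ε _ => ?_
      rw [add_assoc, ← SignTree.signedSum_cons]
      rfl
    refine (Finset.sum_le_sum fun e _ => h1 e).trans ?_
    rw [← Finset.mul_sum, UnitsInt.univ, Finset.sum_pair (by decide)]
    simp only [Units.val_one, Int.cast_one, one_smul, Units.val_neg, Int.cast_neg, neg_smul,
      ← sub_eq_add_neg]
    rw [pow_succ, mul_assoc]
    exact mul_le_mul_of_nonneg_left (hΨ x _ (hz _ _)) (by positivity)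

theorem signProb_eq {T : ℕ} (E : Set (Fin T → ℤˣ)) [DecidablePred (· ∈ E)] :
    signProb E = ENNReal.ofReal ((Finset.univ.filter (· ∈ E)).card / 2 ^ T) := by
  unfold signProb
  rw [PMF.toOuterMeasure_uniformOfFintype_apply, ENNReal.ofReal_div_of_pos (by positivity),
    ENNReal.ofReal_natCast, ENNReal.ofReal_pow (by norm_num)]
  simp [Fintype.card_subtype]

/-- Markov's inequality for the uniform distribution on sign sequences. -/
theorem signProb_le_of_sum_le {T : ℕ} (E : Set (Fin T → ℤˣ)) (f : (Fin T → ℤˣ) → ℝ)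
    (hf : ∀ ε, 0 ≤ f ε) {a b : ℝ} (ha : 0 < a) (hE : ∀ ε ∈ E, a ≤ f ε)
    (hsum : ∑ ε, f ε ≤ 2 ^ T * b) : signProb E ≤ ENNReal.ofReal (b / a) := by
  classical
  rw [signProb_eq]
  refine ENNReal.ofReal_le_ofReal ?_
  rw [div_le_div_iff₀ (by positivity) ha]
  calc ((Finset.univ.filter (· ∈ E)).card : ℝ) * a
      = ∑ ε ∈ Finset.univ.filter (· ∈ E), a := by simp
    _ ≤ ∑ ε ∈ Finset.univ.filter (· ∈ E), f ε :=
        Finset.sum_le_sum fun ε hε => hE ε (Finset.mem_filter.1 hε).2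
    _ ≤ ∑ ε, f ε := Finset.sum_le_univ_sum_of_nonneg hf
    _ ≤ b * 2 ^ T := by linarith

/-- Sub-Gaussian deviations of a signed sum beyond twice `A = (σ T) ^ (1 / p)`. The base point of
the exponential moment is `smoothNorm A p 0 = A`, and the drift over `T` steps is at most `A`. -/
theorem IsSmoothSpace.signProb_norm_signedSum_le (hB : IsSmoothSpace B σ p) {T : ℕ} (hT : 0 < T)
    {A : ℝ} (hA : 0 < A) (hAp : A ^ p = σ * T) {r : ℝ} (hr : 0 < r) (z : SignTree T B)
    (hz : ∀ t s, ‖z t s‖ ≤ r) {u : ℝ} (hu : 0 ≤ u) :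
    signProb {ε | r * (2 * A + u) < ‖z.signedSum ε‖}
      ≤ ENNReal.ofReal (Real.exp (-(u ^ 2 / (2 * T)))) := by
  have hT' : (0 : ℝ) < T := by exact_mod_cast hT
  have hp : 0 < p := by linarith [hB.2.1]
  set z' : SignTree T B := fun t s => r⁻¹ • z t s with hz'
  have hzz : ∀ ε, z'.signedSum ε = r⁻¹ • z.signedSum ε := by
    intro ε
    simp only [SignTree.signedSum, Finset.smul_sum]
    refine Finset.sum_congr rfl fun t _ => ?_
    rw [smul_comm]; rfl
  have hz1 : ∀ t s, ‖z' t s‖ ≤ 1 := by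
    intro t s
    rw [hz', norm_smul, norm_inv, Real.norm_of_nonneg hr.le, inv_mul_le_iff₀ hr, mul_one]
    exact hz t s
  -- the exponent `u / T` minimizes `c ^ 2 * T / 2 - c * u`
  set c := u / T with hc
  have hc0 : 0 ≤ c := by positivity
  have hmgf := SignTree.sum_comp_signedSum_le (fun x : B => Real.exp (c * smoothNorm A p x))
    (Real.exp (c * (A / T) + c ^ 2 / 2)) (Real.exp_pos _).le
    (fun x h hh => hB.exp_smoothNorm_add_le hA hT' hAp hc0 x hh) z' hz1 0
  simp only [zero_add, smoothNorm_zero hA.le hp] at hmgf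
  rw [mul_pow, mul_assoc] at hmgf
  refine (signProb_le_of_sum_le _ _ (fun ε => (Real.exp_pos _).le)
    (Real.exp_pos (c * (2 * A + u))) ?_ hmgf).trans (ENNReal.ofReal_le_ofReal (le_of_eq ?_))
  · intro ε hε
    refine Real.exp_le_exp.2 (mul_le_mul_of_nonneg_left ?_ hc0)
    refine le_trans ?_ (norm_le_smoothNorm hA.le hp _)
    rw [hzz, norm_smul, norm_inv, Real.norm_of_nonneg hr.le, le_inv_mul_iff₀ hr]
    exact le_of_lt hε
  · rw [← Real.exp_nat_mul, ← Real.exp_add, ← Real.exp_sub, hc]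
    congr 1
    field_simp
    ring

end Concentration

/-! ### Covering numbers -/

section Covering

variable {B : Type*} [NormedAddCommGroup B] {F X : Type*} {H : Set B} {T : ℕ}

theorem coveringNumber_antitone (ell : F × X → H)
    (Φ : Set (Fin T → PayoffTransformation F X H)) : Antitone (coveringNumber ell Φ) := by
  intro a b hab
  refine iSup_mono fun fx => ?_
  refine le_iInf₂ fun V hV => iInf₂_le V fun φ hφ ε => ?_
  obtain ⟨v, hv, h⟩ := hV φ hφ ε
  exact ⟨v, hv, fun t => (h t).trans hab⟩

theorem nontrivial_of_two_le_coveringNumber {ell : F × X → H}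
    {Φ : Set (Fin T → PayoffTransformation F X H)} {α : ℝ} (hα : 0 ≤ α) (hT : 0 < T)
    (h : 2 ≤ coveringNumber ell Φ α) : Nontrivial B := by
  by_contra hB
  rw [not_nontrivial_iff_subsingleton] at hB
  have : coveringNumber ell Φ α ≤ 1 := by
    refine iSup_le fun fx => ?_
    refine (iInf₂_le (Set.univ : Set (SignTree T H)) ?_).trans ?_
    · intro φ _ ε
      exact ⟨fun _ _ => ell (fx.along ε ⟨0, hT⟩), mem_univ _, fun t => by
        rw [Subsingleton.elim (_ - _ : B) 0, norm_zero]; exact hα⟩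
    · rw [Set.encard_le_one_iff]
      intro a b _ _
      funext t s
      exact Subsingleton.elim _ _
  exact absurd (h.trans this) (by decide)

/-- A finite covering number is attained, by a finite set of trees that are here regarded as
having values in the whole space. -/
theorem exists_finset_cover (ell : F × X → H) (Φ : Set (Fin T → PayoffTransformation F X H))
    (fx : SignTree T (F × X)) {α : ℝ} (h : coveringNumber ell Φ α ≠ ⊤) :
    ∃ W : Finset (SignTree T B), W.card ≤ (coveringNumber ell Φ α).toNat ∧
      ∀ φ ∈ Φ, ∀ ε, ∃ w ∈ W, ∀ t : Fin T, ‖w.along ε t - (φ t ell (fx.along ε t) : B)‖ ≤ α := by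
  classical
  obtain ⟨n, hn⟩ := ENat.ne_top_iff_exists.1 h
  have h1 : coveringNumberOn ell Φ fx α < (n + 1 : ℕ) := by
    refine (le_iSup (fun fx => coveringNumberOn ell Φ fx α) fx).trans_lt ?_
    change coveringNumber ell Φ α < _
    rw [← hn]
    exact_mod_cast Nat.lt_succ_self n
  obtain ⟨V, hV⟩ := iInf_lt_iff.1 h1
  obtain ⟨hcov, hcard⟩ := iInf_lt_iff.1 hV
  have hfin : V.Finite := Set.finite_of_encard_le_coe hcard.le
  refine ⟨hfin.toFinset.image (fun v => fun t s => (v t s : B)), ?_, ?_⟩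
  · rw [← hn, ENat.toNat_natCast]
    refine Finset.card_image_le.trans ?_
    rw [hfin.encard_eq_coe_toFinset_card] at hcard
    exact Nat.lt_succ_iff.1 (by exact_mod_cast hcard)
  · intro φ hφ ε
    obtain ⟨v, hv, h⟩ := hcov φ hφ ε
    exact ⟨_, Finset.mem_image_of_mem _ (hfin.mem_toFinset.2 hv), h⟩

end Covering

/-! ### The entropy integral -/

theorem sqrtLog_mono : Monotone sqrtLog := by
  intro a b hab
  unfold sqrtLog
  have : (a : ℝ≥0∞) ≤ (b : ℝ≥0∞) := by exact_mod_cast hab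
  have := EReal.toENNReal_le_toENNReal (ENNReal.log_monotone this)
  gcongr

theorem sqrtLog_top : sqrtLog ⊤ = ⊤ := by
  simp [sqrtLog]

theorem sqrtLog_natCast (k : ℕ) :
    sqrtLog (k : ℕ∞) = ENNReal.ofReal (Real.sqrt (Real.log k)) := by
  unfold sqrtLog
  rcases Nat.eq_zero_or_pos k with rfl | hk
  · simp
  · have h : (((k : ℕ∞) : ℝ≥0∞)) = ENNReal.ofReal k := by simp
    rw [h, ENNReal.log_ofReal_of_pos (by exact_mod_cast hk), EReal.toENNReal_of_ne_top
      (EReal.coe_ne_top _), EReal.toReal_coe, ENNReal.ofReal_rpow_of_nonneg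
      (Real.log_natCast_nonneg k) (by norm_num), ← Real.sqrt_eq_rpow]

theorem four_fifths_le_sqrtLog {n : ℕ∞} (hn : 2 ≤ n) : ENNReal.ofReal (4 / 5) ≤ sqrtLog n := by
  refine le_trans ?_ (sqrtLog_mono hn)
  rw [show (2 : ℕ∞) = ((2 : ℕ) : ℕ∞) from rfl, sqrtLog_natCast]
  refine ENNReal.ofReal_le_ofReal (Real.le_sqrt_of_sq_le ?_)
  have := Real.log_two_gt_d9
  push_cast
  linarith

/-- The dyadic lower sum of an antitone function. -/
theorem sum_dyadic_le_lintegral {f : ℝ → ℝ≥0∞} (hf : Antitone f) (J : ℕ) :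
    ∑ j ∈ Finset.range J, ENNReal.ofReal ((1 / 2) ^ (j + 2)) * f ((1 / 2) ^ (j + 1))
      ≤ ∫⁻ δ in Ioc ((1 / 2 : ℝ) ^ (J + 1)) 1, f δ := by
  induction J with
  | zero => simp
  | succ J ih =>
    have h1 : (1 / 2 : ℝ) ^ (J + 1 + 1) ≤ (1 / 2) ^ (J + 1) := by
      rw [pow_succ _ (J + 1)]
      linarith [pow_pos (by norm_num : (0 : ℝ) < 1 / 2) (J + 1)]
    have h2 : (1 / 2 : ℝ) ^ (J + 1) ≤ 1 := pow_le_one₀ (by norm_num) (by norm_num)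
    rw [Finset.sum_range_succ, ← Ioc_union_Ioc_eq_Ioc h1 h2,
      lintegral_union measurableSet_Ioc (Ioc_disjoint_Ioc_of_le le_rfl), add_comm]
    refine add_le_add ?_ ih
    calc ENNReal.ofReal ((1 / 2) ^ (J + 2)) * f ((1 / 2) ^ (J + 1))
        = ∫⁻ _ in Ioc ((1 / 2 : ℝ) ^ (J + 1 + 1)) ((1 / 2) ^ (J + 1)), f ((1 / 2) ^ (J + 1)) := by
          rw [setLIntegral_const, Real.volume_Ioc, mul_comm]
          congr 2
          ring
      _ ≤ _ := setLIntegral_mono' measurableSet_Ioc fun δ hδ => hf hδ.2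

theorem four_fifths_le_lintegral_sqrtLog {N : ℝ → ℕ∞}
    (hN : ∀ δ : ℝ, 0 < δ → δ < 1 / 4 → 2 ≤ N δ) {α : ℝ} (hα : 0 < α) :
    ENNReal.ofReal (4 / 5 * (1 / 4 - α)) ≤ ∫⁻ δ in Ioc α 1, sqrtLog (N δ) := by
  calc ENNReal.ofReal (4 / 5 * (1 / 4 - α))
      = ∫⁻ _ in Ioo α (1 / 4), ENNReal.ofReal (4 / 5) := by
        rw [setLIntegral_const, Real.volume_Ioo, ENNReal.ofReal_mul (by norm_num)]
    _ ≤ ∫⁻ δ in Ioo α (1 / 4), sqrtLog (N δ) :=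
        setLIntegral_mono' measurableSet_Ioo fun δ hδ =>
          four_fifths_le_sqrtLog (hN δ (hα.trans hδ.1) hδ.2)
    _ ≤ ∫⁻ δ in Ioc α 1, sqrtLog (N δ) :=
        lintegral_mono_set fun δ hδ => ⟨hδ.1, hδ.2.le.trans (by norm_num)⟩

/-! ### Chaining along a path -/

section Chaining

variable {B : Type*} [NormedAddCommGroup B] {T : ℕ}

/-- The tree all of whose values are zero. -/
def SignTree.zero (T : ℕ) (B : Type*) [Zero B] : SignTree T B := fun _ _ => 0

/-- The difference of two trees, set to zero at the nodes where it exceeds `r` in norm. The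
truncation makes the increment bounded on all paths, and not only on those on which both trees are
close to a common target. -/
noncomputable def SignTree.truncSub (r : ℝ) (v w : SignTree T B) : SignTree T B :=
  fun t s => if ‖v t s - w t s‖ ≤ r then v t s - w t s else 0

theorem SignTree.norm_truncSub_le {r : ℝ} (hr : 0 ≤ r) (v w : SignTree T B) (t : Fin T)
    (s : Fin t.val → ℤˣ) : ‖v.truncSub r w t s‖ ≤ r := by
  unfold SignTree.truncSub
  split_ifs with h
  · exact h
  · rwa [norm_zero]

theorem SignTree.truncSub_along {r : ℝ} {v w : SignTree T B} {ε : Fin T → ℤˣ} {t : Fin T}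
    (h : ‖v.along ε t - w.along ε t‖ ≤ r) :
    (v.truncSub r w).along ε t = v.along ε t - w.along ε t :=
  if_pos h

variable [NormedSpace ℝ B]

theorem norm_sum_sign_smul_le (ε : Fin T → ℤˣ) (b : Fin T → B) {r : ℝ} (hb : ∀ t, ‖b t‖ ≤ r) :
    ‖∑ t, ((ε t : ℤ) : ℝ) • b t‖ ≤ T * r := by
  refine (norm_sum_le _ _).trans ?_
  have : ∀ t ∈ Finset.univ, ‖((ε t : ℤ) : ℝ) • b t‖ ≤ r := by
    intro t _
    rw [norm_smul]
    rcases Int.units_eq_one_or (ε t) with h | h <;> simpa [h] using hb t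
  refine (Finset.sum_le_sum this).trans (by simp)

/-- The chaining decomposition along a single path. -/
theorem norm_average_le_chaining (hT : 0 < T) (ε : Fin T → ℤˣ) (a : Fin T → B)
    (v : ℕ → SignTree T B) (hv0 : v 0 = SignTree.zero T B) (J : ℕ)
    (hv : ∀ j ≤ J, ∀ t, ‖(v j).along ε t - a t‖ ≤ (1 / 2) ^ j) :
    ‖(1 / (T : ℝ)) • ∑ t, ((ε t : ℤ) : ℝ) • a t‖ ≤ (1 / 2) ^ J +
      ∑ j ∈ Finset.range J,
        ‖((v (j + 1)).truncSub (3 * (1 / 2) ^ (j + 1)) (v j)).signedSum ε‖ / T := by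
  have hT' : (0 : ℝ) < T := by exact_mod_cast hT
  have htel : ∀ K ≤ J, (v K).signedSum ε = ∑ j ∈ Finset.range K,
      ((v (j + 1)).truncSub (3 * (1 / 2) ^ (j + 1)) (v j)).signedSum ε := by
    intro K
    induction K with
    | zero =>
      intro _
      rw [hv0]
      simp [SignTree.signedSum, SignTree.along, SignTree.zero]
    | succ K ih =>
      intro hK
      rw [Finset.sum_range_succ, ← ih (by omega)]
      unfold SignTree.signedSum
      rw [← Finset.sum_add_distrib]
      refine Finset.sum_congr rfl fun t _ => ?_
      rw [SignTree.truncSub_along, ← smul_add, add_sub_cancel]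
      have h1 := hv (K + 1) hK t
      have h2 := hv K (by omega) t
      calc ‖(v (K + 1)).along ε t - (v K).along ε t‖
          = ‖((v (K + 1)).along ε t - a t) - ((v K).along ε t - a t)‖ := by
            rw [sub_sub_sub_cancel_right]
        _ ≤ _ := norm_sub_le _ _
        _ ≤ (1 / 2) ^ (K + 1) + (1 / 2) ^ K := add_le_add h1 h2
        _ = 3 * (1 / 2) ^ (K + 1) := by ring
  have hsplit : ∑ t, ((ε t : ℤ) : ℝ) • a t
      = (v J).signedSum ε - ∑ t, ((ε t : ℤ) : ℝ) • ((v J).along ε t - a t) := by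
    simp only [SignTree.signedSum, smul_sub, Finset.sum_sub_distrib, sub_sub_cancel]
  have h3 := norm_sum_sign_smul_le ε _ (hv J le_rfl)
  have h4 : ‖(v J).signedSum ε‖ ≤ ∑ j ∈ Finset.range J,
      ‖((v (j + 1)).truncSub (3 * (1 / 2) ^ (j + 1)) (v j)).signedSum ε‖ := by
    rw [htel J le_rfl]
    exact norm_sum_le _ _
  rw [norm_smul, Real.norm_of_nonneg (by positivity), one_div_mul_eq_div, div_le_iff₀ hT',
    add_mul, Finset.sum_mul, hsplit]
  refine (norm_sub_le _ _).trans ?_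
  have h5 : ∀ j ∈ Finset.range J,
      ‖((v (j + 1)).truncSub (3 * (1 / 2) ^ (j + 1)) (v j)).signedSum ε‖ / T * T
        = ‖((v (j + 1)).truncSub (3 * (1 / 2) ^ (j + 1)) (v j)).signedSum ε‖ :=
    fun j _ => div_mul_cancel₀ _ hT'.ne'
  rw [Finset.sum_congr rfl h5]
  linarith

/-- The union bound over all increments between two finite sets of trees. -/
theorem IsSmoothSpace.signProb_exists_truncSub_le {σ p : ℝ} (hB : IsSmoothSpace B σ p)
    (hT : 0 < T) {A : ℝ} (hA : 0 < A) (hAp : A ^ p = σ * T) {r : ℝ} (hr : 0 < r)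
    (V W : Finset (SignTree T B)) {n : ℕ} (hV : V.card ≤ n) (hW : W.card ≤ n) {u : ℝ}
    (hu : 0 ≤ u) :
    signProb {ε | ∃ v ∈ V, ∃ w ∈ W, r * (2 * A + u) < ‖(v.truncSub r w).signedSum ε‖}
      ≤ (n : ℝ≥0∞) ^ 2 * ENNReal.ofReal (Real.exp (-(u ^ 2 / (2 * T)))) := by
  have hset : {ε | ∃ v ∈ V, ∃ w ∈ W, r * (2 * A + u) < ‖(v.truncSub r w).signedSum ε‖}
      = ⋃ q ∈ V ×ˢ W, {ε | r * (2 * A + u) < ‖(q.1.truncSub r q.2).signedSum ε‖} := by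
    ext ε
    simp only [mem_ofPred_eq, mem_iUnion, Finset.mem_product, exists_prop, Prod.exists]
    constructor
    · rintro ⟨v, hv, w, hw, h⟩; exact ⟨v, w, ⟨hv, hw⟩, h⟩
    · rintro ⟨v, w, ⟨hv, hw⟩, h⟩; exact ⟨v, hv, w, hw, h⟩
  rw [hset]
  unfold signProb
  refine (measure_biUnion_finset_le _ _).trans ?_
  refine (Finset.sum_le_sum fun q _ => hB.signProb_norm_signedSum_le hT hA hAp hr
    (q.1.truncSub r q.2) (fun t s => SignTree.norm_truncSub_le hr.le _ _ t s) hu).trans ?_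
  rw [Finset.sum_const, nsmul_eq_mul, Finset.card_product]
  refine mul_le_mul_left ?_ _
  exact_mod_cast (Nat.mul_le_mul hV hW).trans_eq (sq n).symm

end Chaining

/-! ### The tail bound -/

/-- At threshold `θ T (1 / 8 + √(log n))` the exponent pays for the `n ^ 2` increments, for a
further factor `n⁻¹` that makes the levels summable, and for the target exponent `E`. -/
theorem sq_mul_exp_le_inv_mul_exp {n T : ℕ} (hn : 0 < n) (hT : 0 < T) {θ M E : ℝ} (hM : 0 < M)
    (hMT : 1 ≤ M ^ 2 * T) (hθ : 512 * M ≤ θ) (hE : E ≤ (θ / M) ^ 2 / 16384) :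
    (n : ℝ≥0∞) ^ 2 * ENNReal.ofReal
        (Real.exp (-((θ * T * (1 / 8 + Real.sqrt (Real.log n))) ^ 2 / (2 * T))))
      ≤ (n : ℝ≥0∞)⁻¹ * ENNReal.ofReal (Real.exp (-E)) := by
  have hn' : (0 : ℝ) < n := by exact_mod_cast hn
  have hT' : (0 : ℝ) < T := by exact_mod_cast hT
  set x := Real.sqrt (Real.log n) with hx
  have hx0 : 0 ≤ x := Real.sqrt_nonneg _
  have hx2 : x ^ 2 = Real.log n := Real.sq_sqrt (Real.log_natCast_nonneg n)
  set Q := (θ / M) ^ 2 with hQ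
  have hQ1 : 512 ^ 2 ≤ Q := by
    have : 512 ≤ θ / M := by rwa [le_div_iff₀ hM]
    rw [hQ]; gcongr
  have hQT : Q ≤ θ ^ 2 * T := by
    rw [hQ, div_pow, div_le_iff₀ (by positivity)]
    nlinarith [sq_nonneg θ]
  have hexp : 3 * x ^ 2 + E ≤ (θ * T * (1 / 8 + x)) ^ 2 / (2 * T) := by
    have e : (θ * T * (1 / 8 + x)) ^ 2 / (2 * T) = θ ^ 2 * T * (1 / 8 + x) ^ 2 / 2 := by
      field_simp
    have h1 : Q * (1 / 8 + x) ^ 2 ≤ θ ^ 2 * T * (1 / 8 + x) ^ 2 := by gcongr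
    have h2 : Q * (1 / 64 + x ^ 2) ≤ Q * (1 / 8 + x) ^ 2 := by
      gcongr
      nlinarith
    have h3 : 512 ^ 2 * x ^ 2 ≤ Q * x ^ 2 := by gcongr
    rw [e]
    nlinarith [sq_nonneg x]
  have hreal : (n : ℝ) ^ 2 * Real.exp (-((θ * T * (1 / 8 + x)) ^ 2 / (2 * T)))
      ≤ (n : ℝ)⁻¹ * Real.exp (-E) := by
    rw [← Real.exp_log hn', ← hx2, ← Real.exp_nat_mul, ← Real.exp_neg, ← Real.exp_add,
      ← Real.exp_add]
    refine Real.exp_le_exp.2 ?_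
    push_cast
    linarith
  have := ENNReal.ofReal_le_ofReal hreal
  rwa [ENNReal.ofReal_mul (by positivity), ENNReal.ofReal_mul (by positivity),
    ENNReal.ofReal_pow hn'.le, ENNReal.ofReal_inv_of_pos hn', ENNReal.ofReal_natCast] at this

/-- The accumulated deviations of the chain fit below the entropy bound at any `α`. For
`α < 1 / 4` the chain stops at the level `J` with `2 ^ (-(J + 2)) < α ≤ 2 ^ (-(J + 1))`. Of the
factor `36`, a part `6` pays for the entropy of the levels; the remainder, since the covering
numbers are at least `2` below `1 / 4`, is at least `24 θ (1 / 4 - α)` and pays for the terms free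
of entropy. -/
theorem le_entropy_bound_of_chaining {N : ℝ → ℕ∞} (hN : Antitone N)
    (hN2 : ∀ δ : ℝ, 0 < δ → δ < 1 / 4 → 2 ≤ N δ) {θ M Y : ℝ} (hθ : 0 < θ) (hM : 0 ≤ M)
    (hY : Y ≤ 1)
    (hchain : ∀ J : ℕ, (∀ j < J, N ((1 / 2) ^ (j + 1)) ≠ ⊤) →
      Y ≤ (1 / 2) ^ J + ∑ j ∈ Finset.range J, 3 * (1 / 2) ^ (j + 1) *
        (2 * M + θ * (1 / 8 + Real.sqrt (Real.log (N ((1 / 2) ^ (j + 1))).toNat))))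
    {α : ℝ} (hα : 0 < α) :
    ENNReal.ofReal Y ≤ ENNReal.ofReal (768 * M) + (ENNReal.ofReal (4 * α) +
      ENNReal.ofReal (36 * θ) * ∫⁻ δ in Ioc α 1, sqrtLog (N δ)) := by
  rcases le_or_gt (1 / 4) α with hα4 | hα4
  · calc ENNReal.ofReal Y ≤ ENNReal.ofReal (4 * α) := ENNReal.ofReal_le_ofReal (by linarith)
      _ ≤ _ := le_add_left le_self_add
  set I := ∫⁻ δ in Ioc α 1, sqrtLog (N δ) with hI
  by_cases hItop : I = ⊤
  · rw [hItop, ENNReal.mul_top (by simpa using hθ)]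
    simp
  obtain ⟨n, hn1, hn2⟩ := exists_nat_pow_near_of_lt_one hα (by linarith : α ≤ 1)
    (by norm_num : (0 : ℝ) < 1 / 2) (by norm_num)
  have hn : 2 ≤ n := by
    by_contra hlt
    have : (1 / 2 : ℝ) ^ 2 ≤ (1 / 2) ^ (n + 1) :=
      pow_le_pow_of_le_one (by norm_num) (by norm_num) (by omega)
    linarith
  obtain ⟨J, rfl⟩ : ∃ J, n = J + 1 := ⟨n - 1, by omega⟩
  have hJ : 1 ≤ J := by omega
  have hsum : ∑ j ∈ Finset.range J, ENNReal.ofReal ((1 / 2) ^ (j + 2)) *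
      sqrtLog (N ((1 / 2) ^ (j + 1))) ≤ I :=
    (sum_dyadic_le_lintegral (f := fun δ => sqrtLog (N δ))
      (sqrtLog_mono.comp_antitone hN) J).trans
      (lintegral_mono_set (Ioc_subset_Ioc_left hn2))
  have hfin : ∀ j < J, N ((1 / 2) ^ (j + 1)) ≠ ⊤ := by
    intro j hj htop
    have h := (Finset.single_le_sum (f := fun j => ENNReal.ofReal ((1 / 2) ^ (j + 2)) *
      sqrtLog (N ((1 / 2) ^ (j + 1)))) (fun _ _ => zero_le) (Finset.mem_range.2 hj)).trans hsum
    simp only [htop, sqrtLog_top] at h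
    rw [ENNReal.mul_top (by simp)] at h
    exact hItop (top_le_iff.1 h)
  have hsumR : ∑ j ∈ Finset.range J, (1 / 2 : ℝ) ^ (j + 2) *
      Real.sqrt (Real.log (N ((1 / 2) ^ (j + 1))).toNat) ≤ I.toReal := by
    rw [← ENNReal.ofReal_le_iff_le_toReal hItop,
      ENNReal.ofReal_sum_of_nonneg (fun _ _ => by positivity)]
    refine le_trans (Finset.sum_le_sum fun j hj => ?_) hsum
    obtain ⟨k, hk⟩ := ENat.ne_top_iff_exists.1 (hfin j (Finset.mem_range.1 hj))
    rw [← hk, ENat.toNat_natCast, sqrtLog_natCast, ENNReal.ofReal_mul (by positivity)]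
  have hquarter : 4 / 5 * (1 / 4 - α) ≤ I.toReal :=
    (ENNReal.ofReal_le_iff_le_toReal hItop).1 (four_fifths_le_lintegral_sqrtLog hN2 hα)
  have hgeom : ∑ j ∈ Finset.range J, (1 / 2 : ℝ) ^ (j + 1) ≤ 1 := by
    have h : ∀ K : ℕ, ∑ j ∈ Finset.range K, (1 / 2 : ℝ) ^ (j + 1) = 1 - (1 / 2) ^ K := by
      intro K
      induction K with
      | zero => simp
      | succ K ih => rw [Finset.sum_range_succ, ih]; ring
    rw [h]
    linarith [pow_pos (by norm_num : (0 : ℝ) < 1 / 2) J]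
  have hYJ : Y ≤ (1 / 2) ^ J + (6 * M + 3 / 8 * θ) + 6 * θ * I.toReal := by
    have e : ∑ j ∈ Finset.range J, 3 * (1 / 2 : ℝ) ^ (j + 1) *
          (2 * M + θ * (1 / 8 + Real.sqrt (Real.log (N ((1 / 2) ^ (j + 1))).toNat)))
        = (6 * M + 3 / 8 * θ) * ∑ j ∈ Finset.range J, (1 / 2 : ℝ) ^ (j + 1)
          + 6 * θ * ∑ j ∈ Finset.range J, (1 / 2 : ℝ) ^ (j + 2) *
            Real.sqrt (Real.log (N ((1 / 2) ^ (j + 1))).toNat) := by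
      rw [Finset.mul_sum, Finset.mul_sum, ← Finset.sum_add_distrib]
      refine Finset.sum_congr rfl fun j _ => ?_
      ring
    have h := hchain J hfin
    rw [e] at h
    have h1 : (6 * M + 3 / 8 * θ) * ∑ j ∈ Finset.range J, (1 / 2 : ℝ) ^ (j + 1)
        ≤ (6 * M + 3 / 8 * θ) * 1 := by gcongr
    have h2 : 6 * θ * ∑ j ∈ Finset.range J, (1 / 2 : ℝ) ^ (j + 2) *
        Real.sqrt (Real.log (N ((1 / 2) ^ (j + 1))).toNat) ≤ 6 * θ * I.toReal := by gcongr
    linarith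
  have hfinal : Y ≤ 768 * M + (4 * α + 36 * θ * I.toReal) := by
    have hI0 : 0 ≤ I.toReal := ENNReal.toReal_nonneg
    have h1 : 30 * θ * (4 / 5 * (1 / 4 - α)) ≤ 30 * θ * I.toReal := by gcongr
    rcases le_or_gt (1 / 6) θ with hθ6 | hθ6
    · nlinarith [mul_nonneg hθ.le hI0]
    · -- `4 α + 24 θ (1 / 4 - α)` is now increasing in `α`
      have h2 : (1 / 2 : ℝ) ^ (J + 1 + 1) ≤ 1 / 8 := by
        calc (1 / 2 : ℝ) ^ (J + 1 + 1) ≤ (1 / 2) ^ 3 :=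
              pow_le_pow_of_le_one (by norm_num) (by norm_num) (by omega)
          _ = 1 / 8 := by norm_num
      have h3 : (1 / 2 : ℝ) ^ J = 4 * (1 / 2) ^ (J + 1 + 1) := by ring
      have h4 : 0 ≤ (α - (1 / 2) ^ (J + 1 + 1)) * (1 / 6 - θ) :=
        mul_nonneg (by linarith) (by linarith)
      nlinarith
  calc ENNReal.ofReal Y ≤ ENNReal.ofReal (768 * M + (4 * α + 36 * θ * I.toReal)) :=
        ENNReal.ofReal_le_ofReal hfinal
    _ = _ := by
      rw [ENNReal.ofReal_add (by positivity) (by positivity),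
        ENNReal.ofReal_add (by positivity) (by positivity),
        ENNReal.ofReal_mul (p := 36 * θ) (by positivity), ENNReal.ofReal_toReal hItop]

/-! ### The uniform deviation bound -/

theorem mainTheorem10
    {B : Type*} [NormedAddCommGroup B] [NormedSpace ℝ B] [CompleteSpace B]
    {F X : Type*} {H : Set B}
    (σ p : ℝ) (hB : IsSmoothSpace B σ p)
    (G : B → ℝ) (hG_nonneg : ∀ z, 0 ≤ G z) (hG_zero : G 0 = 0) (hG_lip : LipschitzWith 1 G)
    (T : ℕ) (hT : 2 ≤ T)
    (ell : F × X → H) (Φ : Set (Fin T → PayoffTransformation F X H))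
    (h_bound : ∀ φ ∈ Φ, ∀ (t : Fin T) (fx : F × X), ‖(φ t ell fx : B)‖ ≤ 1)
    (h_nondeg : ∀ δ : ℝ, 0 < δ → δ < 1 / 4 → 2 ≤ coveringNumber ell Φ δ)
    (L : ℝ)
    (hL : 2 * ∑' j : ℕ, ((coveringNumber ell Φ ((1 / 2 : ℝ) ^ (j + 1)) : ℕ∞) : ℝ≥0∞)⁻¹
      < ENNReal.ofReal L)
    (θ : ℝ)
    (hθ : 1024 * σ ^ (1 / p) * Real.log T ^ (3 / 2 : ℝ) / (T : ℝ) ^ (1 - 1 / p) < θ)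
    (fx : SignTree T (F × X)) :
    signProb {ε : Fin T → ℤˣ |
        ENNReal.ofReal (768 * σ ^ (1 / p) / (T : ℝ) ^ (1 - 1 / p))
            + dudleyBound (coveringNumber ell Φ) (36 * θ)
          < ⨆ φ ∈ Φ, ENNReal.ofReal
              (G ((1 / (T : ℝ)) • ∑ t : Fin T,
                ((ε t : ℤ) : ℝ) • (φ t ell (fx.along ε t) : B)))}
      ≤ ENNReal.ofReal
          (L * Real.exp (-(θ ^ 2 * (T : ℝ) ^ (2 - 2 / p)
            / (65536 * σ ^ (2 / p) * Real.log T ^ 3)))) := by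
  have hT0 : 0 < T := by omega
  have hT' : (0 : ℝ) < T := by exact_mod_cast hT0
  have hT1 : (1 : ℝ) ≤ T := by exact_mod_cast (by omega : 1 ≤ T)
  have hp : 1 < p := hB.2.1
  have hp2 : p ≤ 2 := hB.2.2.1
  have hp0 : 0 < p := by linarith
  have : Nontrivial B := nontrivial_of_two_le_coveringNumber (by norm_num) hT0
    (h_nondeg (1 / 8) (by norm_num) (by norm_num))
  have hσ : 1 ≤ σ := hB.one_le_of_nontrivial
  have hσ0 : 0 < σ := by linarith
  set N := coveringNumber ell Φ
  have hNanti : Antitone N := coveringNumber_antitone ell Φ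
  -- the expected order of magnitude of `‖∑ ε_t z_t‖`, and of its average
  set A := (σ * T) ^ (1 / p) with hA
  have hA0 : 0 < A := by positivity
  have hAp : A ^ p = σ * T := by
    rw [hA, ← Real.rpow_mul (by positivity), one_div_mul_cancel hp0.ne', Real.rpow_one]
  set M := σ ^ (1 / p) / (T : ℝ) ^ (1 - 1 / p) with hMdef
  have hM0 : 0 < M := by positivity
  have hMA : M * T = A := by
    rw [hMdef, hA, Real.mul_rpow hσ0.le hT'.le, Real.rpow_sub hT', Real.rpow_one]
    field_simp
  have hM2 : M ^ 2 = σ ^ (2 / p) / (T : ℝ) ^ (2 - 2 / p) := by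
    rw [hMdef, div_pow, ← Real.rpow_mul_natCast hσ0.le, ← Real.rpow_mul_natCast hT'.le]
    congr 2 <;> · push_cast; ring
  have hMT : 1 ≤ M ^ 2 * T := by
    rw [hM2, div_mul_eq_mul_div, le_div_iff₀ (by positivity), one_mul]
    have h1 : (1 : ℝ) ≤ σ ^ (2 / p) := Real.one_le_rpow hσ (by positivity)
    have h2 : (T : ℝ) ^ (2 - 2 / p) ≤ (T : ℝ) ^ (1 : ℝ) := by
      refine Real.rpow_le_rpow_of_exponent_le hT1 ?_
      have : 1 ≤ 2 / p := by rwa [le_div_iff₀ hp0, one_mul]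
      linarith
    rw [Real.rpow_one] at h2
    nlinarith
  -- the powers of `log T` enter only through these lower bounds
  have hlog : 2 / 3 ≤ Real.log T := by
    have h1 : Real.log 2 ≤ Real.log T := Real.log_le_log (by norm_num) (by exact_mod_cast hT)
    have h2 := Real.log_two_gt_d9
    linarith
  have hlog0 : 0 < Real.log T := by linarith
  have hlog3 : 1 / 4 ≤ Real.log T ^ 3 := by
    calc (1 / 4 : ℝ) ≤ (2 / 3) ^ 3 := by norm_num
      _ ≤ Real.log T ^ 3 := by gcongr
  have hlog32 : 1 / 2 ≤ Real.log T ^ (3 / 2 : ℝ) := by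
    refine (pow_le_pow_iff_left₀ (by norm_num) (by positivity) two_ne_zero).1 ?_
    rw [← Real.rpow_mul_natCast hlog0.le,
      show (3 / 2 : ℝ) * (2 : ℕ) = (3 : ℕ) by norm_num, Real.rpow_natCast]
    linarith
  have hθM : 512 * M ≤ θ := by
    have e : 1024 * σ ^ (1 / p) * Real.log T ^ (3 / 2 : ℝ) / (T : ℝ) ^ (1 - 1 / p)
        = 1024 * M * Real.log T ^ (3 / 2 : ℝ) := by rw [hMdef]; ring
    rw [e] at hθ
    nlinarith
  have hθ0 : 0 < θ := by linarith
  set E := θ ^ 2 * (T : ℝ) ^ (2 - 2 / p) / (65536 * σ ^ (2 / p) * Real.log T ^ 3) with hEdef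
  have hE : E ≤ (θ / M) ^ 2 / 16384 := by
    have e : E = (θ / M) ^ 2 / (65536 * Real.log T ^ 3) := by
      rw [hEdef, div_pow, hM2]
      field_simp
    rw [e]
    gcongr
    linarith
  rw [mul_div_assoc, ← hMdef]
  -- `0⁻¹ = ∞` in the finite sum excludes empty covers
  have hNpos : ∀ j : ℕ, N ((1 / 2) ^ (j + 1)) ≠ 0 := by
    intro j h0
    have h1 := ENNReal.le_tsum (f := fun j : ℕ => ((N ((1 / 2 : ℝ) ^ (j + 1)) : ℕ∞) : ℝ≥0∞)⁻¹) j
    simp only [h0, ENat.toENNReal_zero, ENNReal.inv_zero, top_le_iff] at h1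
    rw [h1] at hL
    simp at hL
  -- finite covers at all scales at which they exist; the coarsest one is the zero tree
  have hcov : ∀ j : ℕ, ∃ W : Finset (SignTree T B), N ((1 / 2) ^ (j + 1)) ≠ ⊤ →
      W.card ≤ (N ((1 / 2) ^ (j + 1))).toNat ∧ ∀ φ ∈ Φ, ∀ ε, ∃ w ∈ W, ∀ t : Fin T,
        ‖w.along ε t - (φ t ell (fx.along ε t) : B)‖ ≤ (1 / 2) ^ (j + 1) := by
    intro j
    by_cases h : N ((1 / 2) ^ (j + 1)) = ⊤
    · exact ⟨∅, fun h' => absurd h h'⟩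
    · obtain ⟨W, hW⟩ := exists_finset_cover ell Φ fx h
      exact ⟨W, fun _ => hW⟩
  choose U hU using hcov
  set W : ℕ → Finset (SignTree T B) := fun j => Nat.casesOn j {SignTree.zero T B} U
  have hW0 : W 0 = {SignTree.zero T B} := rfl
  have hNsucc : ∀ j : ℕ, N ((1 / 2) ^ (j + 1)) ≤ N ((1 / 2) ^ (j + 1 + 1)) := fun j =>
    hNanti (pow_le_pow_of_le_one (by norm_num) (by norm_num) (by omega))
  have hcard : ∀ j : ℕ, N ((1 / 2) ^ (j + 1)) ≠ ⊤ →
      (W j).card ≤ (N ((1 / 2) ^ (j + 1))).toNat := by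
    intro j hj
    rcases j with _ | j
    · rw [hW0, Finset.card_singleton, Nat.one_le_iff_ne_zero]
      exact fun h => (ENat.toNat_eq_zero.1 h).elim (hNpos 0) hj
    · have hj' : N ((1 / 2) ^ (j + 1)) ≠ ⊤ := ne_top_of_le_ne_top hj (hNsucc j)
      exact (hU j hj').1.trans (ENat.toNat_le_toNat (hNsucc j) hj)
  -- the deviation allowed at level `j + 1`; increments are bounded by `2⁻ʲ⁻¹ + 2⁻ʲ = 3 * 2⁻ʲ⁻¹`
  set u : ℕ → ℝ := fun j =>
    θ * T * (1 / 8 + Real.sqrt (Real.log (N ((1 / 2) ^ (j + 1))).toNat)) with hu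
  set bad : ℕ → Set (Fin T → ℤˣ) := fun j => {ε | N ((1 / 2) ^ (j + 1)) ≠ ⊤ ∧
    ∃ v ∈ W (j + 1), ∃ w ∈ W j, 3 * (1 / 2) ^ (j + 1) * (2 * A + u j)
      < ‖(v.truncSub (3 * (1 / 2) ^ (j + 1)) w).signedSum ε‖}
  have hbadProb : ∀ j, signProb (bad j)
      ≤ ((N ((1 / 2 : ℝ) ^ (j + 1)) : ℕ∞) : ℝ≥0∞)⁻¹ * ENNReal.ofReal (Real.exp (-E)) := by
    intro j
    by_cases h : N ((1 / 2) ^ (j + 1)) = ⊤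
    · have : bad j = ∅ := by
        exact Set.eq_empty_of_forall_notMem fun ε hε => hε.1 h
      rw [this, signProb, measure_empty]
      exact zero_le
    · have hpos : 0 < (N ((1 / 2) ^ (j + 1))).toNat :=
        Nat.pos_of_ne_zero fun h0 => (ENat.toNat_eq_zero.1 h0).elim (hNpos j) h
      refine le_trans ?_ ((hB.signProb_exists_truncSub_le hT0 hA0 hAp
        (by positivity : (0 : ℝ) < 3 * (1 / 2) ^ (j + 1)) (W (j + 1)) (W j) (hU j h).1
        (hcard j h) (by positivity : 0 ≤ u j)).trans
        ((sq_mul_exp_le_inv_mul_exp hpos hT0 hM0 hMT hθM hE).trans (le_of_eq ?_)))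
      · exact measure_mono fun ε hε => hε.2
      · congr 2
        rw [← ENat.toENNReal_coe, ENat.natCast_toNat h]
  have hsub : {ε : Fin T → ℤˣ | ENNReal.ofReal (768 * M) + dudleyBound N (36 * θ)
      < ⨆ φ ∈ Φ, ENNReal.ofReal (G ((1 / (T : ℝ)) • ∑ t : Fin T,
          ((ε t : ℤ) : ℝ) • (φ t ell (fx.along ε t) : B)))} ⊆ ⋃ j, bad j := by
    intro ε hε
    by_contra hgood
    rw [mem_ofPred_eq] at hε
    obtain ⟨φ, hε⟩ := lt_iSup_iff.1 hε
    obtain ⟨hφ, hε⟩ := lt_iSup_iff.1 hε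
    -- the threshold is exceeded at a single `α` of the infimum
    obtain ⟨α, hε⟩ := iInf_lt_iff.1 (lt_tsub_iff_left.2 hε)
    obtain ⟨hα, hε⟩ := iInf_lt_iff.1 hε
    refine absurd (lt_tsub_iff_left.1 hε) (not_lt.2 ?_)
    set a : Fin T → B := fun t => (φ t ell (fx.along ε t) : B)
    have ha1 : ∀ t, ‖a t‖ ≤ 1 := fun t => h_bound φ hφ t _
    have hGle : ∀ z, G z ≤ ‖z‖ := by
      intro z
      have h := hG_lip.dist_le_mul z 0
      rw [hG_zero, NNReal.coe_one, one_mul, dist_zero_right, dist_zero_right] at h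
      exact (Real.le_norm_self _).trans h
    refine (ENNReal.ofReal_le_ofReal (hGle _)).trans
      (le_entropy_bound_of_chaining hNanti h_nondeg hθ0 hM0.le ?_ ?_ hα.1)
    · rw [norm_smul, Real.norm_of_nonneg (by positivity), one_div_mul_eq_div, div_le_one hT']
      simpa using norm_sum_sign_smul_le ε a ha1
    · intro J hJ
      have hv : ∀ j : ℕ, ∃ v : SignTree T B, j ≤ J → v ∈ W j ∧
          ∀ t, ‖v.along ε t - a t‖ ≤ (1 / 2) ^ j := by
        intro j
        rcases j with _ | j
        · refine ⟨SignTree.zero T B, fun _ => ⟨Finset.mem_singleton_self _, fun t => ?_⟩⟩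
          simpa [SignTree.along, SignTree.zero] using ha1 t
        · by_cases hj : j + 1 ≤ J
          · obtain ⟨w, hw, h⟩ := (hU j (hJ j hj)).2 φ hφ ε
            exact ⟨w, fun _ => ⟨hw, h⟩⟩
          · exact ⟨SignTree.zero T B, fun h => absurd h hj⟩
      choose v hv using hv
      have hv0 : v 0 = SignTree.zero T B := Finset.mem_singleton.1 (hv 0 (Nat.zero_le _)).1
      refine (norm_average_le_chaining hT0 ε a v hv0 J fun j hj => (hv j hj).2).trans ?_
      refine add_le_add_right (Finset.sum_le_sum fun j hj => ?_) _
      rw [Finset.mem_range] at hj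
      rw [div_le_iff₀ hT']
      have hnot : ε ∉ bad j := fun h => hgood (mem_iUnion.2 ⟨j, h⟩)
      have h := not_lt.1 fun h => hnot
        ⟨hJ j hj, v (j + 1), (hv (j + 1) hj).1, v j, (hv j hj.le).1, h⟩
      refine h.trans (le_of_eq ?_)
      rw [hu, ← hMA]
      ring
  calc signProb _ ≤ signProb (⋃ j, bad j) := measure_mono hsub
    _ ≤ ∑' j, signProb (bad j) := measure_iUnion_le _
    _ ≤ ∑' j : ℕ, ((N ((1 / 2 : ℝ) ^ (j + 1)) : ℕ∞) : ℝ≥0∞)⁻¹ * ENNReal.ofReal (Real.exp (-E)) :=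
        ENNReal.tsum_le_tsum hbadProb
    _ ≤ ENNReal.ofReal L * ENNReal.ofReal (Real.exp (-E)) := by
        rw [ENNReal.tsum_mul_right]
        gcongr
        refine le_trans ?_ hL.le
        rw [two_mul]
        exact le_self_add
    _ = ENNReal.ofReal (L * Real.exp (-E)) := (ENNReal.ofReal_mul' (Real.exp_pos _).le).symm
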